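/- Let $\beta>1$ be a real number, and let $T_\beta(x)=\beta x-\lfloor \beta x\rfloor$ be the $\beta$-transformation. For $x\in[0,1)$ let $\varepsilon_n(x)=\lfloor \beta\, T_\beta^{n-1}x\rfloor$ ($n\ge 1$) be the digits of the $\beta$-expansion of $x$, and let $$r_n(x)=\sup\{k\ge 0:\ \varepsilon_{i+1}(x)=\cdots=\varepsilon_{i+k}(x)=0\ \text{for some}\ 0\le i\le n-k\}$$ be the maximal length of a string of consecutive zeros among the first $n$ digits of the $\beta$-expansion of $x$. Then for every real number $\alpha\ge 0$, $$\dim_{\mathrm H}\left\{x\in[0,1):\ \limsup_{n\to\infty}\frac{r_n(x)}{\log_\beta n}=\alpha\right\}=1,$$ where $\dim_{\mathrm H}$ denotes the Hausdorff dimension. -/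

import Mathlib

namespace BetaExpansion

/-- The `β`-transformation `T_β x = β x - ⌊β x⌋`. -/
noncomputable def betaMap (β x : ℝ) : ℝ := β * x - ⌊β * x⌋

/-- The digits of the `β`-expansion of `x`, indexed from `0`: `digit β x n` is
`ε_{n+1}(x, β) = ⌊β * T_β^n x⌋`. -/
noncomputable def digit (β x : ℝ) (n : ℕ) : ℤ := ⌊β * (betaMap β)^[n] x⌋

/-- The run-length function `r_n(x)`: the largest `k` such that
`ε_{i+1}(x) = ⋯ = ε_{i+k}(x) = 0` for some `0 ≤ i ≤ n - k`, that is, the maximal length of a string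
of consecutive zeros among the first `n` digits of the `β`-expansion of `x`.
The condition `i ≤ n - k` is written `i + k ≤ n`; the set contains `0` and is bounded by `n`, so
the supremum in `ℕ` is its maximum. -/
noncomputable def runLength (β : ℝ) (n : ℕ) (x : ℝ) : ℕ :=
  sSup {k : ℕ | ∃ i : ℕ, i + k ≤ n ∧ ∀ j < k, digit β x (i + j) = 0}

end BetaExpansion

namespace BetaExpansion

/-! Arbitrary digit words need not be admissible for `β`, but words of full cylinders concatenate
freely. Fix `s < s' < 1`. Greedy expansions that follow the expansion of `1` as long as possible
show that there are at least `β ^ L / (L + 1)` full cylinders of order `L`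
(`pow_le_mul_ncard_isFull`). Hence for some `L` there are `N ≥ β ^ (s' * (L + 1))` nonzero ones
(`exists_injective_isFull`).

A sequence of these `N` words, each followed by one zero and by `⌊α log_β j⌋` further zeros when the
block number `j` is a power of `2`, is the expansion of a point. Each word has a nonzero digit, so
long runs of zeros come only from the gaps and the limsup is `α` (`IsBlockExpansion.limsup_eq`).

The gaps before block `k` add up to `O((log k) ^ 2)`, which is negligible against `k`. So reading
the choices of words as base-`N` digits gives a Hölder map of exponent `s` from these points onto
`[0, 1]`, and the dimension is at least `s` (`ofReal_le_dimH_range`). Finally `s` tends to `1`. -/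

/-- The numbers `c + y / β ^ n`, `0 ≤ y < 1`, form a full cylinder of order `n`: they share their
first `n` digits, and `T_β ^ n` maps them onto `[0, 1)`. -/
structure IsFull (β : ℝ) (n : ℕ) (c : ℝ) : Prop where
  nonneg : 0 ≤ c
  add_le : c + 1 / β ^ n ≤ 1
  iterate : ∀ y, 0 ≤ y → y < 1 → (betaMap β)^[n] (c + y / β ^ n) = y
  digit_eq : ∀ y, 0 ≤ y → y < 1 → ∀ i < n, digit β (c + y / β ^ n) i = digit β c i

open Filter Topology

variable {β α : ℝ}

/-! ### Digits, full cylinders and their concatenation -/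

lemma digit_add (x : ℝ) (m i : ℕ) : digit β x (m + i) = digit β ((betaMap β)^[m] x) i := by
  rw [digit, digit, ← Function.iterate_add_apply, Nat.add_comm]

lemma digit_eq_digit_zero (x : ℝ) (n : ℕ) : digit β x n = digit β ((betaMap β)^[n] x) 0 := by
  simpa using digit_add x n 0

lemma betaMap_nonneg (x : ℝ) : 0 ≤ betaMap β x := sub_nonneg.2 (Int.floor_le _)

lemma betaMap_lt_one (x : ℝ) : betaMap β x < 1 := by
  have := Int.lt_floor_add_one (β * x)
  unfold betaMap
  linarith

lemma digit_zero_of_eq (hβ : 1 < β) {b : ℤ} {y : ℝ} (h0 : 0 ≤ y) (h1 : y < 1) :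
    digit β ((b + y) / β) 0 = b := by
  have hb : β ≠ 0 := by positivity
  rw [digit, Function.iterate_zero, id, mul_div_cancel₀ _ hb, Int.floor_eq_iff]
  constructor <;> linarith

lemma betaMap_of_eq (hβ : 1 < β) {b : ℤ} {y : ℝ} (h0 : 0 ≤ y) (h1 : y < 1) :
    betaMap β ((b + y) / β) = y := by
  have hb : β ≠ 0 := by positivity
  have h := digit_zero_of_eq hβ (b := b) h0 h1
  rw [digit, Function.iterate_zero, id] at h
  rw [betaMap, h, mul_div_cancel₀ _ hb]
  ring

namespace IsFull

lemma add_lt {n : ℕ} {c y : ℝ} (hβ : 1 < β) (h : IsFull β n c) (h1 : y < 1) :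
    c + y / β ^ n < 1 := by
  have : y / β ^ n < 1 / β ^ n := by gcongr
  linarith [h.add_le]

lemma add_nonneg {n : ℕ} {c y : ℝ} (hβ : 1 < β) (h : IsFull β n c) (h0 : 0 ≤ y) :
    0 ≤ c + y / β ^ n := by
  have := h.nonneg
  positivity

lemma lt_one {n : ℕ} {c : ℝ} (hβ : 1 < β) (h : IsFull β n c) : c < 1 := by
  simpa using h.add_lt hβ (y := 0) zero_lt_one

lemma iterate_self {n : ℕ} {c : ℝ} (h : IsFull β n c) : (betaMap β)^[n] c = 0 := by
  simpa using h.iterate 0 le_rfl zero_lt_one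

lemma comp {m n : ℕ} {c e : ℝ} (hβ : 1 < β) (hc : IsFull β m c) (he : IsFull β n e) :
    IsFull β (m + n) (c + e / β ^ m) := by
  have hb : β ≠ 0 := by positivity
  have key (y : ℝ) : c + e / β ^ m + y / β ^ (m + n) = c + (e + y / β ^ n) / β ^ m := by
    rw [pow_add]; field_simp; ring
  refine ⟨hc.add_nonneg hβ he.nonneg, ?_, fun y h0 h1 => ?_, fun y h0 h1 i hi => ?_⟩
  · rw [key]
    have : (e + 1 / β ^ n) / β ^ m ≤ 1 / β ^ m := by gcongr; exact he.add_le
    linarith [hc.add_le]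
  · rw [key, Nat.add_comm, Function.iterate_add_apply,
      hc.iterate _ (he.add_nonneg hβ h0) (he.add_lt hβ h1), he.iterate y h0 h1]
  · rw [key]
    rcases lt_or_ge i m with him | him
    · rw [hc.digit_eq _ (he.add_nonneg hβ h0) (he.add_lt hβ h1) i him,
        hc.digit_eq _ he.nonneg (he.lt_one hβ) i him]
    · obtain ⟨k, rfl⟩ := Nat.exists_eq_add_of_le him
      rw [digit_add, digit_add, hc.iterate _ (he.add_nonneg hβ h0) (he.add_lt hβ h1),
        hc.iterate _ he.nonneg (he.lt_one hβ), he.digit_eq y h0 h1 k (by omega)]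

lemma zero (hβ : 1 < β) (n : ℕ) : IsFull β n 0 := by
  induction n with
  | zero => exact ⟨le_rfl, by simp, fun y _ _ => by simp, fun y _ _ i hi => by omega⟩
  | succ n ih =>
    have h1 : IsFull β 1 0 := by
      refine ⟨le_rfl, ?_, fun y h0 h1 => ?_, fun y h0 h1 i hi => ?_⟩
      · rw [pow_one, zero_add]; exact (div_le_one (by positivity)).2 hβ.le
      · simpa using betaMap_of_eq hβ (b := 0) h0 h1
      · obtain rfl : i = 0 := by omega
        have h := digit_zero_of_eq hβ (b := 0) h0 h1
        have h' := digit_zero_of_eq hβ (b := 0) le_rfl zero_lt_one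
        simp only [Int.cast_zero, zero_add, zero_div] at h h'
        simp [h, h']
    simpa using ih.comp hβ h1

lemma mono {m n : ℕ} {c : ℝ} (hβ : 1 < β) (hc : IsFull β m c) (h : m ≤ n) : IsFull β n c := by
  obtain ⟨k, rfl⟩ := Nat.exists_eq_add_of_le h
  simpa using hc.comp hβ (zero hβ k)

lemma digit_eq_zero {L n : ℕ} {c : ℝ} (hc : IsFull β L c) (h : L ≤ n) : digit β c n = 0 := by
  obtain ⟨k, rfl⟩ := Nat.exists_eq_add_of_le h
  have h0 : (betaMap β)^[k] 0 = 0 :=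
    Function.iterate_fixed (by simp [betaMap]) k
  rw [digit_add, hc.iterate_self, digit, h0, mul_zero, Int.floor_zero]

end IsFull

lemma iterate_eq_of_digit_eq_zero {x : ℝ} {n : ℕ} (h : ∀ i < n, digit β x i = 0) :
    (betaMap β)^[n] x = β ^ n * x := by
  induction n with
  | zero => simp
  | succ n ih =>
    have hd := h n n.lt_succ_self
    rw [digit] at hd
    rw [Function.iterate_succ_apply', betaMap, hd, ih fun i hi => h i (by omega)]
    push_cast
    ring

lemma IsFull.exists_digit_ne_zero {n : ℕ} {c : ℝ} (hβ : 1 < β) (hc : IsFull β n c) (h0 : c ≠ 0) :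
    ∃ i < n, digit β c i ≠ 0 := by
  by_contra! h
  have h1 := iterate_eq_of_digit_eq_zero h
  rw [hc.iterate_self] at h1
  have : β ^ n ≠ 0 := by positivity
  simp_all

/-- Distinct full cylinders of the same order are separated. -/
lemma IsFull.one_div_le_sub {n : ℕ} {c e : ℝ} (hβ : 1 < β) (hc : IsFull β n c) (he : IsFull β n e)
    (h : c < e) : 1 / β ^ n ≤ e - c := by
  have hp : 0 < β ^ n := by positivity
  by_contra! hlt
  have h1 : (e - c) * β ^ n < 1 := (lt_div_iff₀ hp).1 hlt
  -- If `e` lay in the cylinder of `c`, its `n`-th iterate would be both `(e - c) * β ^ n > 0` and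
  -- `0`.
  have h2 := hc.iterate ((e - c) * β ^ n) (mul_nonneg (by linarith) hp.le) h1
  rw [mul_div_cancel_right₀ _ hp.ne', add_sub_cancel, he.iterate_self] at h2
  have : 0 < (e - c) * β ^ n := mul_pos (by linarith) hp
  linarith

/-! ### The expansion of `1` and the number of full cylinders -/

lemma iterate_one_nonneg (j : ℕ) : 0 ≤ (betaMap β)^[j] 1 := by
  cases j with
  | zero => simp
  | succ j => rw [Function.iterate_succ_apply']; exact betaMap_nonneg _

lemma iterate_one_le_one (j : ℕ) : (betaMap β)^[j] 1 ≤ 1 := by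
  cases j with
  | zero => simp
  | succ j => rw [Function.iterate_succ_apply']; exact (betaMap_lt_one _).le

lemma iterate_one_succ (j : ℕ) :
    (betaMap β)^[j + 1] 1 = β * (betaMap β)^[j] 1 - digit β 1 j := by
  rw [Function.iterate_succ_apply', betaMap, digit]

/-- The numbers following the expansion of `1` for exactly `j` digits. -/
lemma iterate_and_digit_below_one (hβ : 1 < β) (j : ℕ) : ∀ z, 0 ≤ z → z < (betaMap β)^[j] 1 →
    (betaMap β)^[j] (1 - ((betaMap β)^[j] 1 - z) / β ^ j) = z ∧
    ∀ i < j, digit β (1 - ((betaMap β)^[j] 1 - z) / β ^ j) i = digit β 1 i := by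
  have hb : β ≠ 0 := by positivity
  have hb0 : 0 < β := by positivity
  induction j with
  | zero => intro z _ _; simp
  | succ j ih =>
    intro z h0 h1
    have hd : (0 : ℝ) ≤ digit β 1 j := by
      have : 0 ≤ digit β 1 j := Int.floor_nonneg.2 (mul_nonneg hb0.le (iterate_one_nonneg j))
      exact_mod_cast this
    have hz1 : z < 1 := h1.trans_le (iterate_one_le_one _)
    have h2 : (digit β 1 j + z) / β < (betaMap β)^[j] 1 := by
      rw [div_lt_iff₀ hb0]
      rw [iterate_one_succ] at h1
      linarith
    have key : 1 - ((betaMap β)^[j + 1] 1 - z) / β ^ (j + 1)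
        = 1 - ((betaMap β)^[j] 1 - (digit β 1 j + z) / β) / β ^ j := by
      rw [iterate_one_succ, pow_succ]
      field_simp
      ring
    obtain ⟨h3, h4⟩ := ih _ (by positivity) h2
    rw [key]
    refine ⟨?_, fun i hi => ?_⟩
    · rw [Function.iterate_succ_apply', h3, betaMap_of_eq hβ h0 hz1]
    · rcases Nat.lt_succ_iff_lt_or_eq.1 hi with hi | rfl
      · exact h4 i hi
      · rw [digit_eq_digit_zero, h3, digit_zero_of_eq hβ h0 hz1]

/-- A word which follows the expansion of `1` and then drops below it is full. -/
lemma isFull_of_lt_digit_one (hβ : 1 < β) {j : ℕ} {b : ℤ} (hb0 : 0 ≤ b) (hb : b < digit β 1 j) :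
    IsFull β (j + 1) (1 - ((betaMap β)^[j] 1 - b / β) / β ^ j) := by
  have hβ0 : 0 < β := by positivity
  have hbR : (0 : ℝ) ≤ b := by exact_mod_cast hb0
  have hle : (b + 1) / β ≤ (betaMap β)^[j] 1 := by
    rw [div_le_iff₀ hβ0]
    have h1 : (b : ℝ) + 1 ≤ digit β 1 j := by exact_mod_cast hb
    have h2 : (digit β 1 j : ℝ) ≤ β * (betaMap β)^[j] 1 := Int.floor_le _
    linarith
  have key (y : ℝ) : 1 - ((betaMap β)^[j] 1 - b / β) / β ^ j + y / β ^ (j + 1)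
      = 1 - ((betaMap β)^[j] 1 - (b + y) / β) / β ^ j := by
    rw [pow_succ]
    field_simp
    ring
  have hlt {y : ℝ} (h1 : y < 1) : (b + y) / β < (betaMap β)^[j] 1 :=
    lt_of_lt_of_le (by gcongr) hle
  have h1 : (1 : ℝ) ≤ β ^ j := one_le_pow₀ hβ.le
  have hdig {y : ℝ} (h0 : 0 ≤ y) (hy1 : y < 1) (i : ℕ) (hi : i < j + 1) :
      digit β (1 - ((betaMap β)^[j] 1 - (b + y) / β) / β ^ j) i
        = if i < j then digit β 1 i else b := by
    obtain ⟨h2, h3⟩ := iterate_and_digit_below_one hβ j _ (by positivity) (hlt hy1)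
    split_ifs with hij
    · exact h3 i hij
    · obtain rfl : i = j := by omega
      rw [digit_eq_digit_zero, h2, digit_zero_of_eq hβ h0 hy1]
  refine ⟨?_, ?_, fun y h0 h1 => ?_, fun y h0 h1 i hi => ?_⟩
  · rw [sub_nonneg, div_le_one (by positivity)]
    have := iterate_one_le_one (β := β) j
    have : 0 ≤ b / β := by positivity
    linarith
  · rw [key, sub_le_self_iff]
    exact div_nonneg (by linarith) (by positivity)
  · rw [key, Function.iterate_succ_apply',
      (iterate_and_digit_below_one hβ j _ (by positivity) (hlt h1)).1, betaMap_of_eq hβ h0 h1]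
  · have := hdig le_rfl zero_lt_one i hi
    rw [add_zero] at this
    rw [key, hdig h0 h1 i hi, this]

/-- Every number of `[0, 1)` lies in a full cylinder of order `n - j`, where it continues like
the expansion of `1` for `j` digits. -/
lemma exists_isFull_cover (hβ : 1 < β) {x : ℝ} (h0 : 0 ≤ x) (h1 : x < 1) (n : ℕ) :
    ∃ m j c z, m + j = n ∧ IsFull β m c ∧ 0 ≤ z ∧ z < (betaMap β)^[j] 1 ∧
      x = c + (1 - ((betaMap β)^[j] 1 - z) / β ^ j) / β ^ m := by
  have hβ0 : 0 < β := by positivity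
  induction n with
  | zero => exact ⟨0, 0, 0, x, rfl, .zero hβ 0, h0, by simpa using h1, by simp⟩
  | succ n ih =>
    obtain ⟨m, j, c, z, hmj, hc, hz0, hz1, hx⟩ := ih
    have hle : ⌊β * z⌋ ≤ digit β 1 j := Int.floor_mono (by gcongr)
    have hb0 : 0 ≤ ⌊β * z⌋ := Int.floor_nonneg.2 (by positivity)
    have hzz : z = (⌊β * z⌋ + betaMap β z) / β := by
      rw [betaMap]; field_simp; ring
    -- A digit strictly below that of `1` completes a full word, so the comparison with `1`
    -- restarts; an equal digit prolongs the comparison.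
    rcases hle.lt_or_eq with hlt | heq
    · refine ⟨m + (j + 1), 0, _, betaMap β z, by omega,
        hc.comp hβ (isFull_of_lt_digit_one hβ hb0 hlt), betaMap_nonneg _, betaMap_lt_one _, ?_⟩
      rw [hx]
      nth_rewrite 1 [hzz]
      rw [pow_zero, Function.iterate_zero, id, pow_add, pow_succ]
      field_simp
      ring
    · refine ⟨m, j + 1, c, betaMap β z, by omega, hc, betaMap_nonneg _, ?_, ?_⟩
      · rw [iterate_one_succ, betaMap, heq]
        have : β * z < β * (betaMap β)^[j] 1 := by gcongr
        linarith
      · rw [hx]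
        nth_rewrite 1 [hzz]
        rw [heq, iterate_one_succ, pow_succ]
        field_simp
        ring

lemma finite_setOf_isFull (hβ : 1 < β) (n : ℕ) : {c | IsFull β n c}.Finite := by
  have hp : 0 < β ^ n := by positivity
  refine Set.Finite.of_injOn (f := fun c => ⌊c * β ^ n⌋) (t := Set.Icc 0 ⌊β ^ n⌋)
    (fun c hc => ?_) (fun c hc e he h => ?_) (Set.finite_Icc _ _)
  · refine ⟨Int.floor_nonneg.2 (mul_nonneg hc.nonneg hp.le), Int.floor_mono ?_⟩
    have := (hc.lt_one hβ).le
    nlinarith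
  · have habs := Int.abs_sub_lt_one_of_floor_eq_floor h
    rw [← sub_mul, abs_mul, abs_of_pos hp, ← lt_div_iff₀ hp] at habs
    by_contra hne
    rcases lt_or_gt_of_ne hne with hlt | hlt
    · have := hc.one_div_le_sub hβ he hlt
      rw [abs_of_neg (by linarith)] at habs
      linarith
    · have := he.one_div_le_sub hβ hc hlt
      rw [abs_of_pos (by linarith)] at habs
      linarith

/-- There are at least `β ^ n / (n + 1)` full cylinders of order `n`. -/
lemma pow_le_mul_ncard_isFull (hβ : 1 < β) (n : ℕ) :
    β ^ n ≤ (n + 1) * {c | IsFull β n c}.ncard := by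
  have hβ0 : 0 < β := by positivity
  have hp : 0 < β ^ n := by positivity
  set F := (finite_setOf_isFull hβ n).toFinset with hF
  -- Left endpoint of the piece described by `exists_isFull_cover`, that is, its point with `z = 0`.
  -- Padding the full word with zeros makes its order `n` for every `j`, so each full cylinder
  -- serves at most `n + 1` pieces.
  let a : ℝ × ℕ → ℝ := fun p =>
    p.1 + (1 - (betaMap β)^[p.2] 1 / β ^ p.2) / β ^ (n - p.2)
  have hcov : Set.Ico (0 : ℝ) 1 ⊆
      ⋃ p ∈ F ×ˢ Finset.range (n + 1), Set.Icc (a p) (a p + 1 / β ^ n) := by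
    intro x hx
    obtain ⟨m, j, c, z, hmj, hc, hz0, hz1, hxe⟩ := exists_isFull_cover hβ hx.1 hx.2 n
    have hz2 : z < 1 := hz1.trans_le (iterate_one_le_one j)
    have hn : n - j = m := by omega
    have hxa : x = a (c, j) + z / β ^ n := by
      simp only [a, hn]
      rw [hxe, ← hmj, pow_add]
      field_simp
      ring
    simp only [Set.mem_iUnion]
    refine ⟨(c, j), ?_, ?_, ?_⟩
    · simp only [hF, Finset.mem_product, Set.Finite.mem_toFinset, Finset.mem_range]
      exact ⟨hc.mono hβ (by omega), by omega⟩
    · have : 0 ≤ z / β ^ n := by positivity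
      linarith
    · have : z / β ^ n ≤ 1 / β ^ n := by gcongr
      linarith
  have hvol : (1 : ENNReal) ≤ ∑ p ∈ F ×ˢ Finset.range (n + 1), ENNReal.ofReal (1 / β ^ n) := by
    calc (1 : ENNReal) = MeasureTheory.volume (Set.Ico (0 : ℝ) 1) := by simp
      _ ≤ _ := MeasureTheory.measure_mono hcov
      _ ≤ _ := MeasureTheory.measure_biUnion_finset_le _ _
      _ = _ := by simp
  rw [← ENNReal.ofReal_sum_of_nonneg fun _ _ => by positivity, ENNReal.one_le_ofReal,
    Finset.sum_const, Finset.card_product, Finset.card_range, nsmul_eq_mul, mul_one_div,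
    le_div_iff₀ hp, one_mul, hF, ← Set.ncard_eq_toFinset_card _ (finite_setOf_isFull hβ n)] at hvol
  push_cast at hvol
  linarith

/-! ### Points built from blocks of full words -/

/-- The recursion runs towards infinity and has no starting value: cut it off after `m` steps with
the value `0`. The results increase with `m` and stay below `1`, so they converge. -/
lemma exists_affine_recursion {c r : ℕ → ℝ} (hc : ∀ k, 0 ≤ c k) (hr : ∀ k, 0 ≤ r k)
    (h : ∀ k, c k + r k ≤ 1) :
    ∃ y : ℕ → ℝ, ∀ k, 0 ≤ y k ∧ y k ≤ 1 ∧ y k = c k + r k * y (k + 1) := by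
  let P : ℕ → ℕ → ℝ := fun m => Nat.rec (fun _ => 0) (fun _ f k => c k + r k * f (k + 1)) m
  have P_succ (m k : ℕ) : P (m + 1) k = c k + r k * P m (k + 1) := rfl
  have nonneg (m : ℕ) : ∀ k, 0 ≤ P m k := by
    induction m with
    | zero => exact fun k => le_rfl
    | succ m ih =>
      exact fun k => add_nonneg (hc k) (mul_nonneg (hr k) (ih _))
  have le_one (m : ℕ) : ∀ k, P m k ≤ 1 := by
    induction m with
    | zero => exact fun k => zero_le_one
    | succ m ih =>
      intro k
      rw [P_succ]
      have := mul_le_of_le_one_right (hr k) (ih (k + 1))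
      linarith [h k]
  have step (m : ℕ) : ∀ k, P m k ≤ P (m + 1) k := by
    induction m with
    | zero => exact fun k => nonneg 1 k
    | succ m ih =>
      intro k
      rw [P_succ, P_succ (m + 1)]
      have := mul_le_mul_of_nonneg_left (ih (k + 1)) (hr k)
      linarith
  have lim (k : ℕ) : Tendsto (fun m => P m k) atTop (𝓝 (⨆ m, P m k)) :=
    tendsto_atTop_ciSup (monotone_nat_of_le_succ fun m => step m k)
      ⟨1, by rintro _ ⟨m, rfl⟩; exact le_one m k⟩
  refine ⟨fun k => ⨆ m, P m k, fun k => ⟨?_, ?_, ?_⟩⟩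
  · exact ge_of_tendsto' (lim k) fun m => nonneg m k
  · exact le_of_tendsto' (lim k) fun m => le_one m k
  · refine tendsto_nhds_unique ((tendsto_add_atTop_iff_nat 1).2 (lim k)) ?_
    exact ((lim (k + 1)).const_mul (r k)).const_add (c k)

/-- The position at which the block number `k` starts, the blocks having lengths `ℓ`. -/
def blockStart (ℓ : ℕ → ℕ) (k : ℕ) : ℕ := ∑ j ∈ Finset.range k, ℓ j

lemma blockStart_succ (ℓ : ℕ → ℕ) (k : ℕ) : blockStart ℓ (k + 1) = blockStart ℓ k + ℓ k :=
  Finset.sum_range_succ _ _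

/-- The expansion of `y 0` is the concatenation of blocks of lengths `ℓ k`, where the block `k`
consists of the first `L` digits of `c k`, followed by zeros; `y k` has the expansion which starts
with the block `k`. -/
structure IsBlockExpansion (β : ℝ) (L : ℕ) (ℓ : ℕ → ℕ) (c y : ℕ → ℝ) : Prop where
  lt_length : ∀ k, L < ℓ k
  isFull : ∀ k, IsFull β L (c k)
  nonneg : ∀ k, 0 ≤ y k
  lt_one : ∀ k, y k < 1
  eq_add : ∀ k, y k = c k + y (k + 1) / β ^ ℓ k

lemma exists_isBlockExpansion (hβ : 1 < β) {L : ℕ} {ℓ : ℕ → ℕ} {c : ℕ → ℝ}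
    (hℓ : ∀ k, L < ℓ k) (hc : ∀ k, IsFull β L (c k)) : ∃ y, IsBlockExpansion β L ℓ c y := by
  obtain ⟨y, hy⟩ := exists_affine_recursion (c := c) (r := fun k => 1 / β ^ ℓ k)
    (fun k => (hc k).nonneg) (fun k => by positivity)
    fun k => ((hc k).mono hβ (hℓ k).le).add_le
  have heq (k : ℕ) : y k = c k + y (k + 1) / β ^ ℓ k := by
    rw [(hy k).2.2]; ring
  refine ⟨y, hℓ, hc, fun k => (hy k).1, fun k => ?_, heq⟩
  rw [heq]
  have h1 : y (k + 1) / β ^ ℓ k ≤ 1 / β ^ ℓ k := by gcongr; exact (hy _).2.1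
  have h2 : 1 / β ^ ℓ k < 1 / β ^ L := by gcongr; exact hℓ k
  linarith [(hc k).add_le]

namespace IsBlockExpansion

variable {L : ℕ} {ℓ : ℕ → ℕ} {c y : ℕ → ℝ}

lemma strictMono_blockStart (h : IsBlockExpansion β L ℓ c y) : StrictMono (blockStart ℓ) :=
  strictMono_nat_of_lt_succ fun k => by
    have := h.lt_length k
    rw [blockStart_succ]
    omega

lemma isFull_length (hβ : 1 < β) (h : IsBlockExpansion β L ℓ c y) (k : ℕ) :
    IsFull β (ℓ k) (c k) :=
  (h.isFull k).mono hβ (h.lt_length k).le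

lemma iterate_blockStart (hβ : 1 < β) (h : IsBlockExpansion β L ℓ c y) (k : ℕ) :
    (betaMap β)^[blockStart ℓ k] (y 0) = y k := by
  induction k with
  | zero => simp [blockStart]
  | succ k ih =>
    rw [blockStart_succ, Nat.add_comm, Function.iterate_add_apply, ih, h.eq_add k,
      (h.isFull_length hβ k).iterate _ (h.nonneg _) (h.lt_one _)]

lemma digit_blockStart_add (hβ : 1 < β) (h : IsBlockExpansion β L ℓ c y) {k i : ℕ} (hi : i < ℓ k) :
    digit β (y 0) (blockStart ℓ k + i) = digit β (c k) i := by
  rw [digit_add, h.iterate_blockStart hβ, h.eq_add k,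
    (h.isFull_length hβ k).digit_eq _ (h.nonneg _) (h.lt_one _) i hi]

lemma exists_blockStart_le_lt (h : IsBlockExpansion β L ℓ c y) (i : ℕ) :
    ∃ k, blockStart ℓ k ≤ i ∧ i < blockStart ℓ (k + 1) := by
  induction i with
  | zero =>
    refine ⟨0, by simp [blockStart], ?_⟩
    have := h.strictMono_blockStart (Nat.lt_add_one 0)
    omega
  | succ i ih =>
    obtain ⟨k, h1, h2⟩ := ih
    rcases Nat.lt_or_ge (i + 1) (blockStart ℓ (k + 1)) with h3 | h3
    · exact ⟨k, by omega, h3⟩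
    · have := h.strictMono_blockStart (Nat.lt_add_one (k + 1))
      exact ⟨k + 1, h3, by omega⟩

/-- A run starting in block `k` stops at the latest at the nonzero digit among the first `L` digits
of block `k + 1`. -/
lemma runLength_le (hβ : 1 < β) (h : IsBlockExpansion β L ℓ c y) (hc : ∀ k, c k ≠ 0) {n B : ℕ}
    (hB : ∀ k, blockStart ℓ k ≤ n → ℓ k ≤ B) : runLength β n (y 0) ≤ B + L := by
  refine csSup_le ⟨0, 0, by simp⟩ ?_
  rintro m ⟨i, him, hz⟩
  obtain ⟨k, h1, h2⟩ := h.exists_blockStart_le_lt i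
  obtain ⟨t, htL, ht⟩ := (h.isFull (k + 1)).exists_digit_ne_zero hβ (hc _)
  have hlen := hB k (by omega)
  by_contra! hm
  rw [blockStart_succ] at h2
  refine ht ?_
  rw [← h.digit_blockStart_add hβ (htL.trans (h.lt_length _)), blockStart_succ]
  have := hz (blockStart ℓ k + ℓ k + t - i) (by omega)
  rwa [Nat.add_sub_cancel' (by omega)] at this

lemma le_runLength (hβ : 1 < β) (h : IsBlockExpansion β L ℓ c y) {n k : ℕ}
    (hn : blockStart ℓ (k + 1) ≤ n) : ℓ k - L ≤ runLength β n (y 0) := by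
  refine le_csSup ⟨n, ?_⟩ ⟨blockStart ℓ k + L, ?_, fun j hj => ?_⟩
  · rintro m ⟨i, him, -⟩
    omega
  · have := h.lt_length k
    rw [blockStart_succ] at hn
    omega
  · rw [Nat.add_assoc, h.digit_blockStart_add hβ (by omega)]
    exact (h.isFull k).digit_eq_zero (by omega)

lemma abs_sub_eq (hβ : 1 < β) {c' y' : ℕ → ℝ} (h : IsBlockExpansion β L ℓ c y)
    (h' : IsBlockExpansion β L ℓ c' y') {k : ℕ} (heq : ∀ j < k, c j = c' j) :
    |y 0 - y' 0| = |y k - y' k| / β ^ blockStart ℓ k := by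
  induction k with
  | zero => simp [blockStart]
  | succ k ih =>
    rw [ih fun j hj => heq j (by omega), h.eq_add k, h'.eq_add k, heq k k.lt_succ_self,
      add_sub_add_left_eq_sub, ← sub_div, abs_div, abs_of_pos (a := β ^ ℓ k) (by positivity),
      div_div, ← pow_add, blockStart_succ, Nat.add_comm (ℓ k)]

/-- Distinct full words of order `L` are `1 / β ^ L` apart, while the following blocks contribute at
most `1 / β ^ (L + 1)`; the extra zero forced by `L < ℓ k` keeps the difference positive. -/
lemma le_sub_of_lt (hβ : 1 < β) {c' y' : ℕ → ℝ} (h : IsBlockExpansion β L ℓ c y)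
    (h' : IsBlockExpansion β L ℓ c' y') {k : ℕ} (hlt : c k < c' k) :
    1 / β ^ L - 1 / β ^ (L + 1) ≤ y' k - y k := by
  have h1 := (h.isFull k).one_div_le_sub hβ (h'.isFull k) hlt
  have h2 : 0 ≤ y' (k + 1) / β ^ ℓ k := by
    have := h'.nonneg (k + 1)
    positivity
  have h3 : y (k + 1) / β ^ ℓ k ≤ 1 / β ^ (L + 1) := by
    gcongr
    exacts [(h.lt_one _).le, hβ.le, h.lt_length k]
  rw [h.eq_add k, h'.eq_add k]
  linarith

lemma le_abs_sub (hβ : 1 < β) {c' y' : ℕ → ℝ} (h : IsBlockExpansion β L ℓ c y)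
    (h' : IsBlockExpansion β L ℓ c' y') {k : ℕ} (heq : ∀ j < k, c j = c' j) (hne : c k ≠ c' k) :
    (1 / β ^ L - 1 / β ^ (L + 1)) / β ^ blockStart ℓ k ≤ |y 0 - y' 0| := by
  rw [h.abs_sub_eq hβ h' heq]
  gcongr
  rcases lt_or_gt_of_ne hne with hlt | hlt
  · rw [abs_sub_comm]
    exact (h.le_sub_of_lt hβ h' hlt).trans (le_abs_self _)
  · exact (h'.le_sub_of_lt hβ h hlt).trans (le_abs_self _)

end IsBlockExpansion

/-! ### The sparse gaps and the limsup of the run length -/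

/-- The number of zeros inserted after the block `j`: about `α log_β j` if `j` is a power of `2`,
and none otherwise. -/
noncomputable def zeroGap (β α : ℝ) (j : ℕ) : ℕ :=
  if j = 2 ^ Nat.log 2 j then ⌊α * Real.logb β j⌋₊ else 0

lemma zeroGap_le (hβ : 1 < β) (hα : 0 ≤ α) {j n : ℕ} (h : j ≤ n) :
    (zeroGap β α j : ℝ) ≤ α * Real.logb β n := by
  have h0 (m : ℕ) : 0 ≤ Real.logb β m := by
    rcases Nat.eq_zero_or_pos m with rfl | hm
    · simp
    · exact Real.logb_nonneg hβ (by exact_mod_cast hm)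
  rw [zeroGap]
  split_ifs with hj
  · have hj0 : 0 < j := by rw [hj]; positivity
    refine (Nat.floor_le (mul_nonneg hα (h0 j))).trans ?_
    gcongr
  · simpa using mul_nonneg hα (h0 n)

lemma lt_zeroGap_two_pow (i : ℕ) : α * Real.logb β ((2 ^ i : ℕ) : ℝ) < zeroGap β α (2 ^ i) + 1 := by
  rw [zeroGap, Nat.log_pow Nat.one_lt_two, if_pos rfl]
  exact Nat.lt_floor_add_one _

/-- Below `k` there are at most `log₂ k + 1` powers of `2`. -/
lemma sum_zeroGap_le (hβ : 1 < β) (hα : 0 ≤ α) (k : ℕ) :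
    (∑ j ∈ Finset.range k, (zeroGap β α j : ℝ)) ≤ (Nat.log 2 k + 1) * (α * Real.logb β k) := by
  have h1 : ∑ j ∈ Finset.range k, (zeroGap β α j : ℝ)
      = ∑ j ∈ (Finset.range k).filter fun j => j = 2 ^ Nat.log 2 j, (zeroGap β α j : ℝ) := by
    rw [Finset.sum_filter]
    refine Finset.sum_congr rfl fun j _ => ?_
    split_ifs with hj
    · rfl
    · simp [zeroGap, hj]
  have h2 : ((Finset.range k).filter fun j => j = 2 ^ Nat.log 2 j).card ≤ Nat.log 2 k + 1 := by
    rw [← Finset.card_range (Nat.log 2 k + 1)]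
    refine Finset.card_le_card_of_injOn (Nat.log 2) (fun j hj => ?_) (fun i hi j hj hij => ?_)
    · simp only [Finset.coe_filter, Finset.mem_range, Set.mem_ofPred_eq] at hj
      simp only [Finset.coe_range, Set.mem_Iio]
      exact Nat.lt_succ_of_le (Nat.log_mono_right hj.1.le)
    · simp only [Finset.coe_filter, Finset.mem_range, Set.mem_ofPred_eq] at hi hj
      rw [hi.2, hj.2, hij]
  rw [h1]
  have hk : 0 ≤ α * Real.logb β k := by
    simpa using (Nat.cast_nonneg (zeroGap β α k)).trans (zeroGap_le hβ hα le_rfl)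
  refine (Finset.sum_le_card_nsmul _ _ (α * Real.logb β k) fun j hj => ?_).trans ?_
  · exact zeroGap_le hβ hα (Finset.mem_range.1 (Finset.mem_filter.1 hj).1).le
  · rw [nsmul_eq_mul]
    gcongr
    exact_mod_cast h2

lemma exists_sum_zeroGap_le (hβ : 1 < β) (hα : 0 ≤ α) {ε : ℝ} (hε : 0 < ε) :
    ∃ C : ℝ, 0 ≤ C ∧ ∀ k : ℕ, (∑ j ∈ Finset.range k, (zeroGap β α j : ℝ)) ≤ ε * k + C := by
  have hlogβ := Real.log_pos hβ
  have hlog2 := Real.log_pos one_lt_two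
  have hlim : Tendsto (fun k : ℕ => α / (Real.log β * Real.log 2) * (Real.log k ^ 2 / k)
      + α / Real.log β * (Real.log k ^ 1 / k)) atTop (𝓝 0) := by
    have h (n : ℕ) : Tendsto (fun k : ℕ => Real.log k ^ n / k) atTop (𝓝 0) :=
      (Real.isLittleO_pow_log_id_atTop (n := n)).tendsto_div_nhds_zero.comp tendsto_natCast_atTop_atTop
    simpa using ((h 2).const_mul (α / (Real.log β * Real.log 2))).add
      ((h 1).const_mul (α / Real.log β))
  obtain ⟨K, hK⟩ := eventually_atTop.1 (hlim.eventually_lt_const hε)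
  refine ⟨∑ j ∈ Finset.range (K + 1), (zeroGap β α j : ℝ), by positivity, fun k => ?_⟩
  rcases le_total k (K + 1) with hk | hk
  · have h1 : ∑ j ∈ Finset.range k, (zeroGap β α j : ℝ)
        ≤ ∑ j ∈ Finset.range (K + 1), (zeroGap β α j : ℝ) :=
      Finset.sum_le_sum_of_subset_of_nonneg (Finset.range_mono hk) fun _ _ _ => by positivity
    have : 0 ≤ ε * k := by positivity
    linarith
  · have hk0 : (0 : ℝ) < k := by exact_mod_cast (by omega : 0 < k)
    have hlk : 0 ≤ Real.log k := Real.log_natCast_nonneg k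
    have hC : (0 : ℝ) ≤ ∑ j ∈ Finset.range (K + 1), (zeroGap β α j : ℝ) := by positivity
    have h1 := hK k (by omega)
    have h2 : (Nat.log 2 k : ℝ) ≤ Real.log k / Real.log 2 := by
      simpa [Real.logb] using Real.natLog_le_logb k 2
    have h3 := sum_zeroGap_le hβ hα k
    have h4 : (Nat.log 2 k + 1) * (α * Real.logb β k)
        ≤ (Real.log k / Real.log 2 + 1) * (α * (Real.log k / Real.log β)) := by
      rw [Real.logb]
      gcongr
    have h5 : (Real.log k / Real.log 2 + 1) * (α * (Real.log k / Real.log β))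
        = (α / (Real.log β * Real.log 2) * (Real.log k ^ 2 / k)
          + α / Real.log β * (Real.log k ^ 1 / k)) * k := by
      field_simp
    have h6 := mul_le_mul_of_nonneg_right h1.le hk0.le
    linarith

lemma tendsto_logb_natCast (hβ : 1 < β) :
    Tendsto (fun n : ℕ => Real.logb β n) atTop atTop :=
  (Real.tendsto_logb_atTop hβ).comp tendsto_natCast_atTop_atTop

/-- Upper bound: blocks starting by position `n` have number at most `n`, so runs are at most `α
log_β n + 2L + 1`. Lower bound: block `2 ^ i` ends at a position between `2 ^ i` and `D * 2 ^ i`,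
whose logarithm is `log_β (2 ^ i) + O(1)`. -/
lemma IsBlockExpansion.limsup_eq (hβ : 1 < β) (hα : 0 ≤ α) {L : ℕ} {c y : ℕ → ℝ}
    (h : IsBlockExpansion β L (fun k => L + 1 + zeroGap β α k) c y) (hc : ∀ k, c k ≠ 0) :
    limsup (fun n : ℕ => (((runLength β n (y 0) : ℝ) / Real.logb β (n : ℝ) : ℝ) : EReal)) atTop
      = (α : EReal) := by
  set ℓ : ℕ → ℕ := fun k => L + 1 + zeroGap β α k with hℓ
  have hcoe {ι : Type} {u : ι → ℝ} {f : Filter ι} (hu : Tendsto u f (𝓝 α)) :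
      Tendsto (fun i => (u i : EReal)) f (𝓝 (α : EReal)) :=
    (continuous_coe_real_ereal.tendsto α).comp hu
  refine le_antisymm ?_ ?_
  · have hlim : Tendsto (fun n : ℕ => α + (2 * L + 1) / Real.logb β n) atTop (𝓝 α) := by
      simpa using ((tendsto_logb_natCast hβ).const_div_atTop (2 * L + 1 : ℝ)).const_add α
    rw [← (hcoe hlim).limsup_eq]
    refine limsup_le_limsup ?_
    filter_upwards [(tendsto_logb_natCast hβ).eventually_gt_atTop 0] with n hn
    rw [EReal.coe_le_coe_iff, div_le_iff₀ hn, add_mul, div_mul_cancel₀ _ hn.ne']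
    have h1 := h.runLength_le hβ hc (n := n) (B := L + 1 + ⌊α * Real.logb β n⌋₊) fun k hk => by
      have hkn : k ≤ n := (h.strictMono_blockStart.le_apply).trans hk
      exact Nat.add_le_add_left (Nat.le_floor (zeroGap_le hβ hα hkn)) _
    have h2 : (runLength β n (y 0) : ℝ) ≤ (L + 1 + ⌊α * Real.logb β n⌋₊ : ℕ) + L := by
      exact_mod_cast h1
    have h3 := Nat.floor_le (mul_nonneg hα hn.le)
    push_cast at h2
    linarith
  · obtain ⟨C, hC0, hC⟩ := exists_sum_zeroGap_le hβ hα one_pos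
    -- Chosen so that `(2 ^ i + 1) * (L + 1) + (2 ^ i + 1) + C ≤ 2 ^ i * D`.
    set D : ℝ := 2 * (L + 2 + C) with hD
    have hD1 : 1 ≤ D := by
      have : (0 : ℝ) ≤ L := by positivity
      linarith
    have hφ : Tendsto (fun i : ℕ => blockStart ℓ (2 ^ i + 1)) atTop atTop :=
      h.strictMono_blockStart.tendsto_atTop.comp
        ((tendsto_add_atTop_nat 1).comp (tendsto_pow_atTop_atTop_of_one_lt (one_lt_two : 1 < 2)))
    have hpow : Tendsto (fun i : ℕ => Real.logb β ((2 ^ i : ℕ) : ℝ)) atTop atTop :=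
      (tendsto_logb_natCast hβ).comp (tendsto_pow_atTop_atTop_of_one_lt (one_lt_two : 1 < 2))
    have hlim : Tendsto (fun i : ℕ => α - α * Real.logb β D /
        (Real.logb β ((2 ^ i : ℕ) : ℝ) + Real.logb β D)) atTop (𝓝 α) := by
      simpa using ((tendsto_atTop_add_const_right _ (Real.logb β D) hpow).const_div_atTop
        (α * Real.logb β D)).const_sub α
    rw [← (hcoe hlim).limsup_eq]
    refine le_trans ?_ (limsup_le_limsup_of_le hφ)
    rw [← limsup_comp]
    refine limsup_le_limsup ?_
    filter_upwards [hpow.eventually_gt_atTop 0] with i hi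
    have hDlog : 0 ≤ Real.logb β D := Real.logb_nonneg hβ hD1
    have hp : (1 : ℝ) ≤ 2 ^ i := one_le_pow₀ one_le_two
    have hlen : (blockStart ℓ (2 ^ i + 1) : ℝ) ≤ 2 ^ i * D := by
      have h1 := hC (2 ^ i + 1)
      have h2 : (blockStart ℓ (2 ^ i + 1) : ℝ) = (2 ^ i + 1) * (L + 1)
          + ∑ j ∈ Finset.range (2 ^ i + 1), (zeroGap β α j : ℝ) := by
        simp [blockStart, hℓ, Finset.sum_add_distrib]
      push_cast at h1
      have h3 : (L + 2 + C) * 1 ≤ (L + 2 + C) * 2 ^ i := by gcongr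
      have h4 : C * 1 ≤ C * 2 ^ i := by gcongr
      rw [h2, hD]
      nlinarith
    have hge : (2 : ℝ) ^ i ≤ blockStart ℓ (2 ^ i + 1) := by
      have := h.strictMono_blockStart.le_apply (x := 2 ^ i + 1)
      exact_mod_cast (Nat.le_succ _).trans this
    have hlog : Real.logb β (blockStart ℓ (2 ^ i + 1))
        ≤ Real.logb β ((2 ^ i : ℕ) : ℝ) + Real.logb β D := by
      rw [← Real.logb_mul (by positivity) (by positivity)]
      push_cast
      exact Real.logb_le_logb_of_le hβ (by linarith) hlen
    have hlog' : Real.logb β ((2 ^ i : ℕ) : ℝ) ≤ Real.logb β (blockStart ℓ (2 ^ i + 1)) := by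
      push_cast
      exact Real.logb_le_logb_of_le hβ (by linarith) hge
    have hrun : α * Real.logb β ((2 ^ i : ℕ) : ℝ)
        ≤ runLength β (blockStart ℓ (2 ^ i + 1)) (y 0) := by
      have h1 := h.le_runLength hβ (k := 2 ^ i) le_rfl
      have h2 : ℓ (2 ^ i) - L = zeroGap β α (2 ^ i) + 1 := by simp only [hℓ]; omega
      rw [h2] at h1
      have h3 : (zeroGap β α (2 ^ i) + 1 : ℝ) ≤ runLength β (blockStart ℓ (2 ^ i + 1)) (y 0) := by
        exact_mod_cast h1
      exact (lt_zeroGap_two_pow i).le.trans h3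
    simp only [Function.comp_apply, EReal.coe_le_coe_iff]
    calc α - α * Real.logb β D / (Real.logb β ((2 ^ i : ℕ) : ℝ) + Real.logb β D)
        = α * Real.logb β ((2 ^ i : ℕ) : ℝ)
          / (Real.logb β ((2 ^ i : ℕ) : ℝ) + Real.logb β D) := by
          field_simp
          ring
      _ ≤ runLength β (blockStart ℓ (2 ^ i + 1)) (y 0)
          / (Real.logb β ((2 ^ i : ℕ) : ℝ) + Real.logb β D) := by gcongr
      _ ≤ _ := by
          gcongr
          exact hi.trans_le hlog'

/-! ### Lower bound for the Hausdorff dimension -/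

/-- If the relation `x a ↦ g a` is Hölder continuous of exponent `s` and covers the unit interval,
then the values `x a` have Hausdorff dimension at least `s`. -/
lemma ofReal_le_dimH_range {ι : Type*} {x g : ι → ℝ} {C s : ℝ} (hs : 0 < s) (hC : 0 ≤ C)
    (h : ∀ a b, |g a - g b| ≤ C * |x a - x b| ^ s) (hg : Set.Icc 0 1 ⊆ Set.range g) :
    ENNReal.ofReal s ≤ dimH (Set.range x) := by
  classical
  -- The choice is harmless: by the Hölder bound, `x a = x b` forces `g a = g b`. The value `0` off
  -- the range is never used.
  let f : ℝ → ℝ := fun t => if ht : ∃ a, x a = t then g ht.choose else 0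
  have hf (a : ι) : f (x a) = g a := by
    have ha : ∃ b, x b = x a := ⟨a, rfl⟩
    have h1 := h ha.choose a
    rw [ha.choose_spec, sub_self, abs_zero, Real.zero_rpow hs.ne', mul_zero] at h1
    simp only [f, dif_pos ha]
    exact sub_eq_zero.1 (abs_nonpos_iff.1 h1)
  have hhol : HolderOnWith C.toNNReal s.toNNReal f (Set.range x) := by
    rintro _ ⟨a, rfl⟩ _ ⟨b, rfl⟩
    rw [hf, hf, edist_dist, edist_dist, Real.dist_eq, Real.dist_eq, Real.coe_toNNReal s hs.le,
      ENNReal.ofReal_rpow_of_nonneg (abs_nonneg _) hs.le]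
    change _ ≤ ENNReal.ofReal C * _
    rw [← ENNReal.ofReal_mul hC]
    exact ENNReal.ofReal_le_ofReal (h a b)
  have himg : Set.Icc 0 1 ⊆ f '' Set.range x := by
    intro t ht
    obtain ⟨a, rfl⟩ := hg ht
    exact ⟨x a, ⟨a, rfl⟩, hf a⟩
  have hdim : dimH (Set.Icc (0 : ℝ) 1) = 1 := by
    rw [Real.dimH_of_nonempty_interior (by simp)]
    simp
  have hspos : 0 < s.toNNReal := Real.toNNReal_pos.2 hs
  have h1 : (1 : ENNReal) ≤ dimH (Set.range x) / s.toNNReal := by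
    rw [← hdim]
    exact (dimH_mono himg).trans (hhol.dimH_image_le hspos)
  rw [ENNReal.le_div_iff_mul_le (Or.inl (by simpa using hs)) (Or.inl ENNReal.coe_ne_top),
    one_mul] at h1
  exact h1

/-- There are many full cylinders of the same order other than the first one. -/
lemma exists_injective_isFull (hβ : 1 < β) {s : ℝ} (hs : s < 1) :
    ∃ (L N : ℕ) (e : Fin N → ℝ), 1 < N ∧ β ^ (s * (L + 1)) ≤ (N : ℝ) ∧ Function.Injective e ∧
      ∀ i, IsFull β L (e i) ∧ e i ≠ 0 := by
  have hβ0 : 0 < β := by positivity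
  have hr1 : β ^ (s - 1) < 1 := Real.rpow_lt_one_of_one_lt_of_neg hβ (by linarith)
  have hr0 : 0 < β ^ (s - 1) := by positivity
  have hi1 : β⁻¹ < 1 := inv_lt_one_of_one_lt₀ hβ
  -- Multiplied by `β ^ L`, the expression is `(L + 1) * (β ^ (s * (L + 1)) + 3)`. The `3` covers
  -- the removal of the cylinder at `0` and leaves `1 < N`.
  have hlim : Tendsto (fun L : ℕ => β ^ s * (L * (β ^ (s - 1)) ^ L + (β ^ (s - 1)) ^ L)
      + 3 * (L * β⁻¹ ^ L + β⁻¹ ^ L)) atTop (𝓝 0) := by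
    have h {r : ℝ} (h0 : 0 < r) (h1 : r < 1) :
        Tendsto (fun L : ℕ => L * r ^ L + r ^ L) atTop (𝓝 0) := by
      simpa using (tendsto_self_mul_const_pow_of_lt_one h0.le h1).add
        (tendsto_pow_atTop_nhds_zero_of_lt_one h0.le h1)
    simpa using ((h hr0 hr1).const_mul (β ^ s)).add ((h (by positivity) hi1).const_mul 3)
  obtain ⟨L, hL⟩ := (hlim.eventually_lt_const one_pos).exists
  have hfin := finite_setOf_isFull hβ L
  set F := hfin.toFinset.erase 0
  have hcard : ({c | IsFull β L c}.ncard : ℝ) ≤ F.card + 1 := by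
    rw [Set.ncard_eq_toFinset_card _ hfin]
    exact_mod_cast Nat.sub_le_iff_le_add.1 Finset.pred_card_le_card_erase
  have hpow := pow_le_mul_ncard_isFull hβ L
  have hbound : β ^ (s * (L + 1)) + 3 ≤ F.card + 1 := by
    have hp : 0 < β ^ L := by positivity
    have h1 : (β ^ (s - 1)) ^ L * β ^ L * β ^ s = β ^ (s * (L + 1)) := by
      rw [← Real.rpow_natCast, ← Real.rpow_natCast, ← Real.rpow_mul hβ0.le, ← Real.rpow_add hβ0,
        ← Real.rpow_add hβ0]
      ring_nf
    have h2 : β⁻¹ ^ L * β ^ L = 1 := by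
      rw [← mul_pow, inv_mul_cancel₀ hβ0.ne', one_pow]
    have h3 : (L + 1) * (β ^ (s * (L + 1)) + 3) < β ^ L := by
      have := mul_lt_mul_of_pos_right hL hp
      calc (L + 1) * (β ^ (s * (L + 1)) + 3)
          = (L + 1) * ((β ^ (s - 1)) ^ L * β ^ L * β ^ s + 3 * (β⁻¹ ^ L * β ^ L)) := by
            rw [h1, h2, mul_one]
        _ = _ := by ring
        _ < _ := this
        _ = _ := one_mul _
    have h4 : (L + 1) * (β ^ (s * (L + 1)) + 3) < (L + 1) * (F.card + 1 : ℝ) :=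
      h3.trans_le (hpow.trans (by gcongr))
    exact (lt_of_mul_lt_mul_left h4 (by positivity)).le
  refine ⟨L, F.card, fun i => F.equivFin.symm i, ?_, by linarith, ?_, fun i => ?_⟩
  · have : 0 < β ^ (s * (L + 1)) := by positivity
    have h1 : (1 : ℝ) < F.card := by linarith
    exact_mod_cast h1
  · exact Subtype.val_injective.comp F.equivFin.symm.injective
  · have hi := (F.equivFin.symm i).2
    exact ⟨hfin.mem_toFinset.1 (Finset.mem_of_mem_erase hi), Finset.ne_of_mem_erase hi⟩

lemma ofReal_le_dimH_limsup_runLength_eq (hβ : 1 < β) {α : ℝ} (hα : 0 ≤ α) {s : ℝ} (hs0 : 0 < s)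
    (hs1 : s < 1) :
    ENNReal.ofReal s ≤ dimH {x : ℝ | x ∈ Set.Ico (0 : ℝ) 1 ∧
      limsup (fun n : ℕ => (((runLength β n x : ℝ) / Real.logb β (n : ℝ) : ℝ) : EReal)) atTop
        = (α : EReal)} := by
  have hβ0 : 0 < β := by positivity
  obtain ⟨s', hss', hs'1⟩ := exists_between hs1
  obtain ⟨L, N, e, hN, hNle, hinj, he⟩ := exists_injective_isFull hβ hs'1
  have hN0 : (0 : ℝ) < N := by exact_mod_cast (by omega : 0 < N)
  -- The slack `(s' - s) * (L + 1)` per block pays for all the gaps, up to the constant `C`.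
  obtain ⟨C, hC0, hC⟩ := exists_sum_zeroGap_le hβ hα (ε := (s' - s) * (L + 1))
    (mul_pos (by linarith) (by positivity))
  set ℓ : ℕ → ℕ := fun k => L + 1 + zeroGap β α k with hℓ
  have hex (a : ℕ → Fin N) : ∃ y, IsBlockExpansion β L ℓ (fun k => e (a k)) y :=
    exists_isBlockExpansion hβ (fun k => by simp only [hℓ]; omega) fun k => (he _).1
  choose y hy using hex
  have hstart (k : ℕ) : β ^ (s * blockStart ℓ k) ≤ N ^ k * β ^ C := by
    have h1 : s * blockStart ℓ k ≤ s' * (L + 1) * k + C := by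
      have h2 : (blockStart ℓ k : ℝ) = k * (L + 1)
          + ∑ j ∈ Finset.range k, (zeroGap β α j : ℝ) := by
        simp [blockStart, hℓ, Finset.sum_add_distrib]
      have h3 : (0 : ℝ) ≤ ∑ j ∈ Finset.range k, (zeroGap β α j : ℝ) := by positivity
      have h4 := mul_le_of_le_one_left h3 hs1.le
      rw [h2]
      linarith [hC k]
    calc β ^ (s * blockStart ℓ k) ≤ β ^ (s' * (L + 1) * k + C) :=
          Real.rpow_le_rpow_of_exponent_le hβ.le h1
      _ = (β ^ (s' * (L + 1))) ^ k * β ^ C := by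
          rw [Real.rpow_add hβ0, Real.rpow_mul hβ0.le _ k, Real.rpow_natCast]
      _ ≤ _ := by gcongr
  set κ : ℝ := 1 / β ^ L - 1 / β ^ (L + 1) with hκ
  have hκ0 : 0 < κ := by
    rw [hκ, sub_pos]
    gcongr
    exact L.lt_succ_self
  -- If `a` and `b` first differ at `k`, the base-`N` values are within `N ^ (-k)`, while the points
  -- are at least `κ / β ^ blockStart ℓ k` apart; `hstart` compares the two scales.
  have hhol (a b : ℕ → Fin N) :
      |Real.ofDigits a - Real.ofDigits b| ≤ β ^ C / κ ^ s * |y a 0 - y b 0| ^ s := by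
    rcases eq_or_ne a b with rfl | hab
    · simp only [sub_self, abs_zero]
      positivity
    obtain ⟨k, hk, hmin⟩ : ∃ k, a k ≠ b k ∧ ∀ j < k, a j = b j := by
      classical
      have hex : ∃ k, a k ≠ b k := Function.ne_iff.1 hab
      exact ⟨Nat.find hex, Nat.find_spec hex, fun j hj => not_not.1 (Nat.find_min hex hj)⟩
    have h1 := (hy a).le_abs_sub hβ (hy b) (k := k) (fun j hj => by rw [hmin j hj])
      fun h => hk (hinj h)
    calc |Real.ofDigits a - Real.ofDigits b| ≤ ((N : ℝ) ^ k)⁻¹ :=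
          Real.abs_ofDigits_sub_ofDigits_le hmin
      _ ≤ β ^ C / β ^ (s * blockStart ℓ k) := by
          rw [inv_eq_one_div, div_le_div_iff₀ (by positivity) (by positivity), one_mul,
            mul_comm (β ^ C)]
          exact hstart k
      _ = β ^ C / κ ^ s * (κ / β ^ blockStart ℓ k) ^ s := by
          rw [Real.div_rpow hκ0.le (by positivity), mul_comm s, Real.rpow_mul hβ0.le,
            Real.rpow_natCast]
          field_simp
      _ ≤ _ := by gcongr
  refine (ofReal_le_dimH_range hs0 (by positivity) hhol ?_).trans (dimH_mono ?_)
  · intro t ht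
    obtain ⟨a, -, ha⟩ := Real.ofDigits_SurjOn hN ht
    exact ⟨a, ha⟩
  · rintro _ ⟨a, rfl⟩
    exact ⟨⟨(hy a).nonneg 0, (hy a).lt_one 0⟩, (hy a).limsup_eq hβ hα fun k => (he _).2⟩

end BetaExpansion

theorem mainTheorem12 (β : ℝ) (hβ : 1 < β) (α : ℝ) (hα : 0 ≤ α) :
    dimH {x : ℝ | x ∈ Set.Ico (0 : ℝ) 1 ∧
      Filter.limsup
        (fun n : ℕ => (((BetaExpansion.runLength β n x : ℝ) / Real.logb β (n : ℝ) : ℝ) : EReal))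
        Filter.atTop = (α : EReal)} = 1 := by
  refine le_antisymm ?_ ?_
  · exact (dimH_mono (Set.subset_univ _)).trans_eq Real.dimH_univ
  · refine le_of_forall_lt fun t ht => ?_
    obtain ⟨r, htr, hr⟩ := exists_between ht
    have hr0 : 0 < r.toReal := ENNReal.toReal_pos (bot_le.trans_lt htr).ne' hr.ne_top
    have hr1 : r.toReal < 1 := by
      simpa using (ENNReal.toReal_lt_toReal hr.ne_top ENNReal.one_ne_top).2 hr
    have h := BetaExpansion.ofReal_le_dimH_limsup_runLength_eq hβ hα hr0 hr1
    rw [ENNReal.ofReal_toReal hr.ne_top] at h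
    exact htr.trans_le h
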